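/- Let $n\ge 1$, let $F\subset\mathbb{R}^n$ be a compact convex set and $X\subset\mathbb{R}^n$ a set, both contained in the closed Euclidean unit ball. Let $R$ be a self-concordant barrier for $F$: $R$ is convex and $C^3$ on $\operatorname{int}F$, $|D^3R(h)[u,u,u]|\le 2\,(D^2R(h)[u,u])^{3/2}$ for all $h\in\operatorname{int} F$, $u\in\mathbb{R}^n$, and $R(h)\to+\infty$ as $h\in\operatorname{int}F$ tends to a boundary point of $F$ (so $R=+\infty$ on $\partial F$). Normalize $\min_{F}R=0$. Let $\Pi$ be a finite nonempty set of models and let $\eta>0$. The algorithm "SCRiBLe while learning the predictable process" runs for rounds $t=1,\dots,T$. It starts with $q_1(\pi)=1/|\Pi|$ for all $\pi\in\Pi$, and $h_1=\arg\min_{F}R$. In round $t$: - the predictions $M^\pi_t$, $\pi\in\Pi$, with $\|M_t^\pi\|\le 1$, are revealed; put $M_t=\sum_{\pi}q_t(\pi)M^\pi_t$; if $t\ge 2$, let $h_t=\arg\min_{h\in F}\bigl[\eta\langle h,\sum_{s<t}\tilde x_s+M_t\rangle+R(h)\bigr]$; - let $e_1,\dots,e_n$ be an orthonormal basis of eigenvectors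 of $\nabla^2R(h_t)$ with eigenvalues $\lambda_1,\dots,\lambda_n$; draw $i_t$ uniformly from $\{1,\dots,n\}$ and an independent uniform sign $\varepsilon_t=\pm1$, independently of the past; play $f_t=h_t+\varepsilon_t\lambda_{i_t}^{-1/2}e_{i_t}$ and observe only $\langle f_t,x_t\rangle$; - put $\tilde x_t=n\langle f_t,x_t-M_t\rangle\,\varepsilon_t\lambda_{i_t}^{1/2}e_{i_t}+M_t$ and let $q_{t+1}(\pi)\propto q_t(\pi)\,e^{-(\langle f_t,x_t\rangle-\langle f_t,M^\pi_t\rangle)^2}$. Nature's move $x_t\in X$ and the predictions $M_t^\pi$ may depend arbitrarily on the draws $(i_s,\varepsilon_s)$, $s<t$ (hence on the whole past of the game), but not on $(i_t,\varepsilon_t)$. Assume that $M_1=0$ and that, on every trajectory and for all $t\le T$, $$\eta\,n\,|\langle f_t,x_t-M_t\rangle|<\tfrac14$$ (this holds for instance if $\eta<1/(8n)$; the left side is $\eta$ times the norm of $\tilde x_t-M_t$ dual to the local norm given by $\nabla^2R(h_t)$). Then for every fixed $f^*\in\operatorname{int}F$ (for $f^*\in\partial F$ the bounds are $+\infty$),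 $$\mathbb{E}\Bigl[\sum_{t=1}^T\langle f_t,x_t\rangle-\sum_{t=1}^T\langle f^*,x_t\rangle\Bigr]\le\eta^{-1}R(f^*)+2\eta n^2\,\mathbb{E}\Bigl[\sum_{t=1}^T\langle f_t,x_t-M_t\rangle^2\Bigr]\le\eta^{-1}R(f^*)+13\,\eta n^2\Bigl(\mathbb{E}\Bigl[\inf_{\pi\in\Pi}\sum_{t=1}^T\|x_t-M^\pi_t\|^2\Bigr]+\log|\Pi|\Bigr).$$ -/

import Mathlib

open scoped BigOperators

noncomputable section

/-- `ℝⁿ` with its Euclidean inner product and norm. -/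
abbrev Vec (n : ℕ) : Type := EuclideanSpace ℝ (Fin n)

/-- The randomness used in one round: an index `i ∈ {1, …, n}` and a sign `ε = ±1`. -/
abbrev Draw (n : ℕ) : Type := Fin n × ℤˣ

/-- The sign of a draw as a real number. -/
def Draw.sign {n : ℕ} (d : Draw n) : ℝ := ((d.2 : ℤ) : ℝ)

/-- The Hessian of `R` at `h`, as a bilinear form. -/
def hess {n : ℕ} (R : Vec n → ℝ) (h u w : Vec n) : ℝ :=
  fderiv ℝ (fderiv ℝ R) h u w

/-- The third derivative of `R` at `h`, as a trilinear form. -/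
def thirdDeriv {n : ℕ} (R : Vec n → ℝ) (h u w z : Vec n) : ℝ :=
  fderiv ℝ (fderiv ℝ (fderiv ℝ R)) h u w z

/-- `R` is a self-concordant barrier for `F`: on the interior of `F` it is convex, three times
continuously differentiable and satisfies `|D³R(h)[u,u,u]| ≤ 2 (D²R(h)[u,u])^(3/2)`, and it tends
to `+∞` at every boundary point of `F`. Only the values of `R` on the interior of `F` matter;
on the boundary `R` is regarded as `+∞`. -/
structure IsSelfConcordantBarrier {n : ℕ} (F : Set (Vec n)) (R : Vec n → ℝ) : Prop where
  contDiffOn : ContDiffOn ℝ 3 R (interior F)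
  convexOn : ConvexOn ℝ (interior F) R
  third_le : ∀ h ∈ interior F, ∀ u : Vec n,
    |thirdDeriv R h u u u| ≤ 2 * √(hess R h u u) ^ 3
  tendsto_boundary : ∀ y ∈ frontier F,
    Filter.Tendsto R (nhdsWithin y (interior F)) Filter.atTop

/-- `argmin_{h ∈ F} [η ⟨h, S⟩ + R(h)]` (the objective is `+∞` on the boundary of `F`). -/
def regLeader {n : ℕ} (F : Set (Vec n)) (R : Vec n → ℝ) (η : ℝ) (S : Vec n) : Vec n :=
  Classical.epsilon fun h : Vec n =>
    h ∈ interior F ∧ IsMinOn (fun g : Vec n => η * inner ℝ g S + R g) (interior F) h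

/-- The data of the game: the decision set `F`, the regularizer `R`, the learning rate `η`, the
strategy `x` of Nature, the predictable processes `M π`, and the eigenvectors and eigenvalues used
by the learner. Time is indexed from `0`. Everything in round `t` may depend on the draws of the
previous rounds `0, …, t - 1` (hence on everything that happened in those rounds), but not on the
draw of round `t`. -/
structure BanditGame (n : ℕ) (Model : Type*) where
  F : Set (Vec n)
  R : Vec n → ℝ
  η : ℝ
  x : (t : ℕ) → (Fin t → Draw n) → Vec n
  M : Model → (t : ℕ) → (Fin t → Draw n) → Vec n
  eigvec : (t : ℕ) → (Fin t → Draw n) → OrthonormalBasis (Fin n) ℝ (Vec n)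
  eigval : (t : ℕ) → (Fin t → Draw n) → Fin n → ℝ

/-- What the learner carries from one round to the next: the mixing weights over the models, and
the sum of the estimated moves so far. -/
structure LearnerState (n : ℕ) (Model : Type*) where
  q : Model → ℝ
  S : Vec n

namespace BanditGame

variable {n : ℕ} {Model : Type*} [Fintype Model] (A : BanditGame n Model)

/-- The mixed prediction `M_t = ∑ π, q_t(π) M_t^π`. -/
def mixOf (s : LearnerState n Model) (t : ℕ) (past : Fin t → Draw n) : Vec n :=
  ∑ π, s.q π • A.M π t past

/-- The point `h_t`: the minimizer of `R` in the first round, and afterwards the minimizer of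
`η ⟨h, ∑_{s < t} x̃_s + M_t⟩ + R(h)`. -/
def centerOf (s : LearnerState n Model) : (t : ℕ) → (Fin t → Draw n) → Vec n
  | 0, _ => regLeader A.F A.R A.η 0
  | t + 1, past => regLeader A.F A.R A.η (s.S + A.mixOf s (t + 1) past)

/-- The decision `f_t = h_t + ε_t λ_{i_t}^{-1/2} e_{i_t}`. -/
def playOf (s : LearnerState n Model) (t : ℕ) (past : Fin t → Draw n) (d : Draw n) : Vec n :=
  A.centerOf s t past + (d.sign * (√(A.eigval t past d.1))⁻¹) • A.eigvec t past d.1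

/-- The estimated move `x̃_t = n ⟨f_t, x_t - M_t⟩ ε_t λ_{i_t}^{1/2} e_{i_t} + M_t`. -/
def estimateOf (s : LearnerState n Model) (t : ℕ) (past : Fin t → Draw n) (d : Draw n) : Vec n :=
  (n * inner ℝ (A.playOf s t past d) (A.x t past - A.mixOf s t past) * d.sign *
    √(A.eigval t past d.1)) • A.eigvec t past d.1 + A.mixOf s t past

/-- The unnormalized new weight `q_t(π) exp(-(⟨f_t, x_t⟩ - ⟨f_t, M_t^π⟩)²)`. -/
def weightOf (s : LearnerState n Model) (t : ℕ) (past : Fin t → Draw n) (d : Draw n)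
    (π : Model) : ℝ :=
  s.q π * Real.exp (-(inner ℝ (A.playOf s t past d) (A.x t past) -
    inner ℝ (A.playOf s t past d) (A.M π t past)) ^ 2)

/-- SCRiBLe while learning the predictable process: the learner's state at the beginning of
round `t`, given the draws of the previous rounds. -/
def state : (t : ℕ) → (Fin t → Draw n) → LearnerState n Model
  | 0, _ => ⟨fun _ => 1 / (Fintype.card Model : ℝ), 0⟩
  | t + 1, past =>
    let prev : Fin t → Draw n := Fin.init past
    let d : Draw n := past (Fin.last t)
    let s := state t prev
    ⟨fun π => A.weightOf s t prev d π / ∑ ρ, A.weightOf s t prev d ρ,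
      s.S + A.estimateOf s t prev d⟩

/-- `h_t`, given the draws of the previous rounds. -/
def center (t : ℕ) (past : Fin t → Draw n) : Vec n := A.centerOf (A.state t past) t past

variable {T : ℕ}

/-- The draws of the rounds before `t`. -/
def before {n T : ℕ} (ω : Fin T → Draw n) (t : Fin T) : Fin (t : ℕ) → Draw n :=
  fun s => ω (Fin.castLE t.isLt.le s)

/-- The learner's decision `f_t` when the draws are `ω`. -/
def fAt (ω : Fin T → Draw n) (t : Fin T) : Vec n :=
  A.playOf (A.state t (before ω t)) t (before ω t) (ω t)

/-- Nature's move `x_t` when the draws are `ω`. -/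
def xAt (ω : Fin T → Draw n) (t : Fin T) : Vec n := A.x t (before ω t)

/-- The prediction `M_t^π` of the model `π` when the draws are `ω`. -/
def modelAt (π : Model) (ω : Fin T → Draw n) (t : Fin T) : Vec n := A.M π t (before ω t)

/-- The learner's mixed prediction `M_t` when the draws are `ω`. -/
def mixAt (ω : Fin T → Draw n) (t : Fin T) : Vec n :=
  A.mixOf (A.state t (before ω t)) t (before ω t)

end BanditGame

end

open Filter Topology

/-! The regret splits into a probabilistic identity and two deterministic bounds valid on every
trajectory. Averaged over the draw of round `t`, `f_t` becomes `h_t` and `x̃_t` becomes `x_t`, so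
the regret against `f*` has the same mean as `∑ ⟨h_t - f*, x̃_t⟩`
(`sum_regret_sub_estimate_eq_zero`).

That sum is bounded pathwise by optimistic follow-the-regularized-leader (`sum_le_objective`).
Self-concordance makes the objective grow by at least `r²/(2(1+r))` at local distance `r` from its
minimizer `h_t` (`le_sub_of_isMinOn`). Replacing the guess `M_t` by `x̃_t` costs at most `s r`,
where `s` is `η` times the dual local norm of `x̃_t - M_t`. The growth absorbs this up to `2 s²`,
and `s = η n |⟨f_t, x_t - M_t⟩|`. Consecutive minimizers never have to be compared.

For the second inequality, `⟨f_t, x_t - M_t⟩` is the `q_t`-mean of numbers whose squares are the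
losses of the models. These losses are at most 4, because the Dikin ellipsoid keeps `f_t` in `F`,
hence in the unit ball. Exponential weights then bound the sum of squared means by a constant times
the best model's loss plus `log |Π|` (`sum_pathError_sq_le`). -/

/-- A nonnegative function with `|φ'| ≤ 2 φ^(3/2)` changes slowly: `φ^(-1/2)` is `1`-Lipschitz. -/
theorem sqrt_sub_sqrt_le_of_selfConcordant {s : Set ℝ} (hs : Convex ℝ s) {φ φ' : ℝ → ℝ}
    (hφ : ∀ t ∈ s, HasDerivAt φ (φ' t) t) (h0 : ∀ t ∈ s, 0 ≤ φ t)
    (hφ' : ∀ t ∈ s, |φ' t| ≤ 2 * √(φ t) ^ 3) {a b : ℝ} (ha : a ∈ s) (hb : b ∈ s) :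
    √(φ b) - √(φ a) ≤ |b - a| * (√(φ a) * √(φ b)) := by
  -- `φ` may vanish, so `φ^(-1/2)` is replaced by `(φ + ε)^(-1/2)`. Its Lipschitz bound, cleared of
  -- denominators, survives `ε → 0`.
  have key : ∀ ε : ℝ, 0 < ε →
      √(φ b + ε) - √(φ a + ε) ≤ |b - a| * (√(φ a + ε) * √(φ b + ε)) := by
    intro ε hε
    have hpos : ∀ t ∈ s, 0 < √(φ t + ε) := fun t ht => Real.sqrt_pos.2 (by linarith [h0 t ht])
    have hd : ∀ t ∈ s, HasDerivWithinAt (fun t => (√(φ t + ε))⁻¹)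
        (-(φ' t / (2 * √(φ t + ε))) / √(φ t + ε) ^ 2) s t := fun t ht =>
      ((((hφ t ht).add_const ε).sqrt (by linarith [h0 t ht])).fun_inv
        (hpos t ht).ne').hasDerivWithinAt
    have hbd : ∀ t ∈ s, ‖-(φ' t / (2 * √(φ t + ε))) / √(φ t + ε) ^ 2‖ ≤ 1 := by
      intro t ht
      have hp := hpos t ht
      have h1 : √(φ t) ^ 3 ≤ √(φ t + ε) ^ 3 := by gcongr; linarith
      rw [Real.norm_eq_abs, abs_div, abs_neg, abs_div, abs_of_pos (pow_pos hp 2),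
        abs_of_pos (mul_pos two_pos hp), div_div, div_le_one (by positivity)]
      linarith [hφ' t ht]
    have hlip := hs.norm_image_sub_le_of_norm_hasDerivWithin_le hd hbd hb ha
    rw [Real.norm_eq_abs, Real.norm_eq_abs, one_mul, abs_sub_comm a b] at hlip
    have hpa := hpos a ha
    have hpb := hpos b hb
    have h2 := mul_le_mul_of_nonneg_left ((le_abs_self _).trans hlip) (mul_pos hpa hpb).le
    have h3 : √(φ a + ε) * √(φ b + ε) * ((√(φ a + ε))⁻¹ - (√(φ b + ε))⁻¹) =
        √(φ b + ε) - √(φ a + ε) := by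
      field_simp
    rw [h3] at h2
    linarith
  have lim : ∀ c : ℝ, Tendsto (fun ε => √(c + ε)) (𝓝[>] 0) (𝓝 √c) := by
    intro c
    have : ContinuousAt (fun ε => √(c + ε)) 0 := by fun_prop
    simpa using this.tendsto.mono_left nhdsWithin_le_nhds
  exact le_of_tendsto_of_tendsto ((lim _).sub (lim _)) (((lim _).mul (lim _)).const_mul _)
    (eventually_mem_nhdsWithin.mono key)

/-! ### Self-concordant barriers: Dikin ellipsoids, minimizers and growth -/

namespace IsSelfConcordantBarrier

variable {n : ℕ} {F : Set (Vec n)} {R : Vec n → ℝ}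

theorem contDiffAt (hR : IsSelfConcordantBarrier F R) {h : Vec n} (hh : h ∈ interior F) :
    ContDiffAt ℝ 3 R h :=
  hR.contDiffOn.contDiffAt (isOpen_interior.mem_nhds hh)

theorem hasDerivAt_line (hR : IsSelfConcordantBarrier F R) {h u : Vec n} {t : ℝ}
    (ht : h + t • u ∈ interior F) :
    HasDerivAt (fun s : ℝ => R (h + s • u)) (fderiv ℝ R (h + t • u) u) t := by
  have hl : HasDerivAt (fun s : ℝ => h + s • u) u t := by
    simpa using ((hasDerivAt_id t).smul_const u).const_add h
  exact ((hR.contDiffAt ht).differentiableAt (by norm_num)).hasFDerivAt.comp_hasDerivAt t hl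

theorem hasDerivAt_fderiv_line (hR : IsSelfConcordantBarrier F R) {h u : Vec n} {t : ℝ}
    (ht : h + t • u ∈ interior F) :
    HasDerivAt (fun s : ℝ => fderiv ℝ R (h + s • u) u) (hess R (h + t • u) u u) t := by
  have hl : HasDerivAt (fun s : ℝ => h + s • u) u t := by
    simpa using ((hasDerivAt_id t).smul_const u).const_add h
  have h2 : ContDiffAt ℝ 2 (fderiv ℝ R) (h + t • u) :=
    (hR.contDiffAt ht).fderiv_right (by norm_num)
  have h3 := (h2.differentiableAt (by norm_num)).hasFDerivAt.comp_hasDerivAt t hl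
  exact (ContinuousLinearMap.apply ℝ ℝ u).hasFDerivAt.comp_hasDerivAt t h3

theorem hasDerivAt_hess_line (hR : IsSelfConcordantBarrier F R) {h u : Vec n} {t : ℝ}
    (ht : h + t • u ∈ interior F) :
    HasDerivAt (fun s : ℝ => hess R (h + s • u) u u) (thirdDeriv R (h + t • u) u u u) t := by
  have hl : HasDerivAt (fun s : ℝ => h + s • u) u t := by
    simpa using ((hasDerivAt_id t).smul_const u).const_add h
  have h2 : ContDiffAt ℝ 2 (fderiv ℝ R) (h + t • u) :=
    (hR.contDiffAt ht).fderiv_right (by norm_num)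
  have h3 : ContDiffAt ℝ 1 (fderiv ℝ (fderiv ℝ R)) (h + t • u) :=
    h2.fderiv_right (by norm_num)
  have h4 := (h3.differentiableAt (by norm_num)).hasFDerivAt.comp_hasDerivAt t hl
  have h5 := (ContinuousLinearMap.apply ℝ (Vec n →L[ℝ] ℝ) u).hasFDerivAt.comp_hasDerivAt t h4
  exact (ContinuousLinearMap.apply ℝ ℝ u).hasFDerivAt.comp_hasDerivAt t h5

/-- The parameters at which a line runs in the interior of `F`. -/
theorem isOpen_line (F : Set (Vec n)) (h u : Vec n) :
    IsOpen {t : ℝ | h + t • u ∈ interior F} :=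
  isOpen_interior.preimage (by fun_prop)

theorem line_combo (h u : Vec n) (x y : ℝ) {a b : ℝ} (hab : a + b = 1) :
    a • (h + x • u) + b • (h + y • u) = h + (a • x + b • y) • u := by
  obtain rfl : b = 1 - a := by linarith
  simp only [smul_eq_mul]
  module

theorem convex_line (hF : Convex ℝ F) (h u : Vec n) :
    Convex ℝ {t : ℝ | h + t • u ∈ interior F} := by
  intro x hx y hy a b ha hb hab
  have := hF.interior hx hy ha hb hab
  rwa [line_combo h u x y hab] at this

theorem hess_nonneg (hR : IsSelfConcordantBarrier F R) (hF : Convex ℝ F) {h : Vec n}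
    (hh : h ∈ interior F) (u : Vec n) : 0 ≤ hess R h u u := by
  set L : Set ℝ := {t : ℝ | h + t • u ∈ interior F} with hL
  have h0 : (0 : ℝ) ∈ L := by simpa [hL] using hh
  have hconv : ConvexOn ℝ L (fun t : ℝ => R (h + t • u)) := by
    refine ⟨convex_line hF h u, fun x hx y hy a b ha hb hab => ?_⟩
    have := hR.convexOn.2 hx hy ha hb hab
    rwa [line_combo h u x y hab] at this
  have hmono := hconv.monotoneOn_deriv fun t ht => (hR.hasDerivAt_line ht).differentiableAt
  have hmono' : MonotoneOn (fun t : ℝ => fderiv ℝ R (h + t • u) u) L :=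
    hmono.congr fun t ht => (hR.hasDerivAt_line ht).deriv
  have h1 : 0 ≤ derivWithin (fun t : ℝ => fderiv ℝ R (h + t • u) u) L 0 :=
    hmono'.derivWithin_nonneg
  have h2 : h + (0 : ℝ) • u ∈ interior F := h0
  rw [derivWithin_of_mem_nhds ((isOpen_line F h u).mem_nhds h0),
    (hR.hasDerivAt_fderiv_line h2).deriv] at h1
  simpa using h1

theorem sqrt_hess_sub_le (hR : IsSelfConcordantBarrier F R) (hF : Convex ℝ F) {h u : Vec n}
    {a b : ℝ} (ha : h + a • u ∈ interior F) (hb : h + b • u ∈ interior F) :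
    √(hess R (h + b • u) u u) - √(hess R (h + a • u) u u) ≤
      |b - a| * (√(hess R (h + a • u) u u) * √(hess R (h + b • u) u u)) :=
  sqrt_sub_sqrt_le_of_selfConcordant (convex_line hF h u) (φ := fun t => hess R (h + t • u) u u)
    (fun _ ht => hR.hasDerivAt_hess_line ht) (fun _ ht => hR.hess_nonneg hF ht u)
    (fun _ ht => hR.third_le _ ht u) ha hb

/-- The open Dikin ellipsoid lies in the interior of the domain. -/
theorem add_mem_interior_of_hess_lt_one (hR : IsSelfConcordantBarrier F R) (hF : Convex ℝ F)
    {h u : Vec n} (hh : h ∈ interior F) (hu : hess R h u u < 1) : h + u ∈ interior F := by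
  by_contra hout
  set r := √(hess R h u u) with hr
  have hr0 : 0 ≤ r := Real.sqrt_nonneg _
  have hr1 : r < 1 := by rw [hr, Real.sqrt_lt' one_pos]; simpa using hu
  -- `τ` is the first exit time of the segment from the interior. Before `τ` the second derivative,
  -- hence the first, hence `R` itself stays bounded, whereas the barrier must blow up at the exit
  -- point.
  obtain ⟨τ, ⟨⟨hτ0, hτ1⟩, hτ⟩, hmin⟩ :=
    (isCompact_Icc.inter_right (isOpen_line F h u).isClosed_compl).exists_isLeast
      (s := Set.Icc (0 : ℝ) 1 ∩ {t : ℝ | h + t • u ∈ interior F}ᶜ) ⟨1, by simpa using hout⟩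
  have hτpos : 0 < τ := by
    rcases hτ0.eq_or_lt with h0 | h0
    · subst h0
      exact absurd (by simpa using hh) hτ
    · exact h0
  have hin : ∀ t ∈ Set.Ico 0 τ, h + t • u ∈ interior F := by
    intro t ht
    by_contra hcon
    exact absurd (hmin ⟨⟨ht.1, ht.2.le.trans hτ1⟩, hcon⟩) (not_le.2 ht.2)
  have h0mem : (0 : ℝ) ∈ Set.Ico 0 τ := ⟨le_rfl, hτpos⟩
  have hh0 : h + (0 : ℝ) • u ∈ interior F := hin 0 h0mem
  set C := (r / (1 - r)) ^ 2 with hC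
  have hC0 : 0 ≤ C := sq_nonneg _
  -- With `ρ` the local norm of `u` at time `t`, self-concordance gives `ρ - r ≤ t r ρ ≤ r ρ`, and
  -- `r < 1` allows solving for `ρ`.
  have hess_le : ∀ t ∈ Set.Ico 0 τ, ‖hess R (h + t • u) u u‖ ≤ C := by
    intro t ht
    have h1 := hR.sqrt_hess_sub_le hF hh0 (hin t ht)
    rw [zero_smul, add_zero, ← hr, sub_zero, abs_of_nonneg ht.1] at h1
    have hnn := hR.hess_nonneg hF (hin t ht) u
    set ρ := √(hess R (h + t • u) u u) with hρ
    have hρ0 : 0 ≤ ρ := Real.sqrt_nonneg _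
    have h2 : t * (r * ρ) ≤ r * ρ := mul_le_of_le_one_left (by positivity) (by linarith [ht.2])
    have h3 : ρ ≤ r / (1 - r) := by rw [le_div_iff₀ (by linarith)]; linarith
    calc ‖hess R (h + t • u) u u‖ = ρ ^ 2 := by
          rw [Real.norm_eq_abs, abs_of_nonneg hnn, hρ, Real.sq_sqrt hnn]
      _ ≤ C := pow_le_pow_left₀ hρ0 h3 2
  have grad_le : ∀ t ∈ Set.Ico 0 τ, ‖fderiv ℝ R (h + t • u) u‖ ≤ |fderiv ℝ R h u| + C := by
    intro t ht
    have h1 := (convex_Ico 0 τ).norm_image_sub_le_of_norm_hasDerivWithin_le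
      (fun s hs => (hR.hasDerivAt_fderiv_line (hin s hs)).hasDerivWithinAt) hess_le h0mem ht
    rw [zero_smul, add_zero, sub_zero, Real.norm_eq_abs, Real.norm_eq_abs, abs_of_nonneg ht.1] at h1
    have h2 : C * t ≤ C := mul_le_of_le_one_right hC0 (by linarith [ht.2])
    rw [Real.norm_eq_abs]
    linarith [abs_sub_abs_le_abs_sub (fderiv ℝ R (h + t • u) u) (fderiv ℝ R h u)]
  set K := |fderiv ℝ R h u| + C with hK
  have hK0 : 0 ≤ K := by positivity
  have val_le : ∀ t ∈ Set.Ico 0 τ, R (h + t • u) ≤ R h + K := by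
    intro t ht
    have h1 := (convex_Ico 0 τ).norm_image_sub_le_of_norm_hasDerivWithin_le
      (fun s hs => (hR.hasDerivAt_line (hin s hs)).hasDerivWithinAt) grad_le h0mem ht
    rw [zero_smul, add_zero, sub_zero, Real.norm_eq_abs, Real.norm_eq_abs, abs_of_nonneg ht.1] at h1
    have h2 : K * t ≤ K := mul_le_of_le_one_right hK0 (by linarith [ht.2])
    linarith [le_abs_self (R (h + t • u) - R h)]
  have hev : ∀ᶠ t in 𝓝[<] τ, t ∈ Set.Ico 0 τ :=
    mem_of_superset (Ioo_mem_nhdsLT hτpos) Set.Ioo_subset_Ico_self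
  have htend : Tendsto (fun t : ℝ => h + t • u) (𝓝[<] τ) (𝓝[interior F] (h + τ • u)) := by
    refine tendsto_nhdsWithin_iff.2 ⟨?_, hev.mono hin⟩
    have : ContinuousAt (fun t : ℝ => h + t • u) τ := by fun_prop
    exact this.tendsto.mono_left nhdsWithin_le_nhds
  have hfr : h + τ • u ∈ frontier F :=
    ⟨closure_mono interior_subset (mem_closure_iff_nhdsWithin_neBot.2 htend.neBot), hτ⟩
  have hinf := ((hR.tendsto_boundary _ hfr).comp htend).eventually_gt_atTop (R h + K)
  obtain ⟨t, ht, ht'⟩ := (hinf.and hev).exists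
  exact absurd (val_le t ht') (not_le.2 ht)

/-- On a bounded domain the Hessian of a self-concordant barrier is positive definite. -/
theorem hess_pos (hR : IsSelfConcordantBarrier F R) (hF : Convex ℝ F)
    (hb : Bornology.IsBounded F) {h u : Vec n} (hh : h ∈ interior F) (hu : u ≠ 0) :
    0 < hess R h u u := by
  refine (hR.hess_nonneg hF hh u).lt_of_ne fun h0 => ?_
  obtain ⟨C, hC⟩ := hb.exists_norm_le
  -- All multiples of a degenerate direction have local norm zero, so the Dikin ellipsoid contains a
  -- whole line, which a bounded `F` cannot.
  have hall : ∀ t : ℝ, h + t • u ∈ F := fun t => interior_subset <|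
    hR.add_mem_interior_of_hess_lt_one hF hh (by simp [hess] at h0 ⊢; simp [← h0])
  have h1 := hC _ (hall ((C + ‖h‖ + 1) / ‖u‖))
  have hC0 : 0 ≤ C := (norm_nonneg _).trans (hC _ (hall 0))
  have h2 : ‖((C + ‖h‖ + 1) / ‖u‖) • u‖ = C + ‖h‖ + 1 := by
    rw [norm_smul, Real.norm_of_nonneg (by positivity), div_mul_cancel₀ _ (norm_ne_zero_iff.2 hu)]
  have h3 := norm_sub_le (h + ((C + ‖h‖ + 1) / ‖u‖) • u) h
  rw [add_sub_cancel_left, h2] at h3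
  linarith

/-- The closed Dikin ellipsoid lies in the closure of the domain. -/
theorem add_mem_of_hess_le_one (hR : IsSelfConcordantBarrier F R) (hF : Convex ℝ F)
    (hcl : IsClosed F) {h u : Vec n} (hh : h ∈ interior F) (hu : hess R h u u ≤ 1) :
    h + u ∈ F := by
  have hin : ∀ s ∈ Set.Ioo (0 : ℝ) 1, h + s • u ∈ F := by
    intro s hs
    refine interior_subset (hR.add_mem_interior_of_hess_lt_one hF hh ?_)
    have : hess R h (s • u) (s • u) = s * (s * hess R h u u) := by simp [hess]
    rw [this]
    have h0 := hR.hess_nonneg hF hh u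
    calc s * (s * hess R h u u) ≤ s * (s * 1) := by have := hs.1.le; gcongr
      _ < 1 := by nlinarith [hs.1, hs.2]
  have htend : Tendsto (fun s : ℝ => h + s • u) (𝓝[<] 1) (𝓝 (h + u)) := by
    have : ContinuousAt (fun s : ℝ => h + s • u) 1 := by fun_prop
    simpa using this.tendsto.mono_left nhdsWithin_le_nhds
  exact hcl.mem_of_tendsto htend (mem_of_superset (Ioo_mem_nhdsLT one_pos) hin)

theorem exists_isMinOn (hR : IsSelfConcordantBarrier F R) (hF : IsCompact F)
    (hne : (interior F).Nonempty) (η : ℝ) (S : Vec n) :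
    ∃ h ∈ interior F, IsMinOn (fun g : Vec n => η * inner ℝ g S + R g) (interior F) h := by
  obtain ⟨g₀, hg₀⟩ := hne
  set G : Vec n → ℝ := fun g => η * inner ℝ g S + R g with hG
  have hlin : Continuous fun g : Vec n => η * inner ℝ g S := by fun_prop
  have hcont : ContinuousOn G (interior F) := hlin.continuousOn.add hR.contDiffOn.continuousOn
  -- This sublevel set is compact: it cannot accumulate at the boundary, where `R`, and with it the
  -- objective, tends to `+∞`.
  set K : Set (Vec n) := {g ∈ interior F | G g ≤ G g₀} with hK
  have hKint : K ⊆ interior F := fun g hg => hg.1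
  have hKcl : IsClosed K := by
    refine isClosed_of_closure_subset fun y hy => ?_
    have hne : (𝓝[K] y).NeBot := mem_closure_iff_nhdsWithin_neBot.1 hy
    have hle : ∀ᶠ g in 𝓝[K] y, G g ≤ G g₀ := eventually_mem_nhdsWithin.mono fun g hg => hg.2
    by_cases hyi : y ∈ interior F
    · exact ⟨hyi, le_of_tendsto ((hcont y hyi).mono_left (nhdsWithin_mono y hKint)) hle⟩
    · have hfr : y ∈ frontier F := ⟨closure_mono (hKint.trans interior_subset) hy, hyi⟩
      have h1 : Tendsto R (𝓝[K] y) atTop :=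
        (hR.tendsto_boundary y hfr).mono_left (nhdsWithin_mono y hKint)
      have h2 : Tendsto G (𝓝[K] y) atTop :=
        Tendsto.add_atTop ((hlin.tendsto y).mono_left nhdsWithin_le_nhds) h1
      obtain ⟨g, hg, hg'⟩ := ((h2.eventually_gt_atTop (G g₀)).and hle).exists
      exact absurd hg' (not_le.2 hg)
  have hKc : IsCompact K := hF.of_isClosed_subset hKcl (hKint.trans interior_subset)
  obtain ⟨h, hh, hmin⟩ := hKc.exists_isMinOn ⟨g₀, hg₀, le_rfl⟩ (hcont.mono hKint)
  refine ⟨h, hh.1, fun g hg => ?_⟩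
  by_cases hgK : G g ≤ G g₀
  · exact hmin ⟨hg, hgK⟩
  · exact hh.2.trans (not_le.1 hgK).le

theorem regLeader_spec (hR : IsSelfConcordantBarrier F R) (hF : IsCompact F)
    (hne : (interior F).Nonempty) (η : ℝ) (S : Vec n) :
    regLeader F R η S ∈ interior F ∧
      IsMinOn (fun g : Vec n => η * inner ℝ g S + R g) (interior F) (regLeader F R η S) :=
  Classical.epsilon_spec (p := fun h : Vec n => h ∈ interior F ∧
    IsMinOn (fun g : Vec n => η * inner ℝ g S + R g) (interior F) h)
    (hR.exists_isMinOn hF hne η S)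

/-- Growth of the regularized objective away from its minimizer. -/
theorem le_sub_of_isMinOn (hR : IsSelfConcordantBarrier F R) (hF : Convex ℝ F) {η : ℝ}
    {S h g : Vec n} (hh : h ∈ interior F) (hg : g ∈ interior F)
    (hmin : IsMinOn (fun g : Vec n => η * inner ℝ g S + R g) (interior F) h) :
    hess R h (g - h) (g - h) / (2 * (1 + √(hess R h (g - h) (g - h)))) ≤
      (η * inner ℝ g S + R g) - (η * inner ℝ h S + R h) := by
  set u := g - h with hu
  set r := √(hess R h u u) with hr
  have hr0 : 0 ≤ r := Real.sqrt_nonneg _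
  have hrsq : hess R h u u = r ^ 2 := (Real.sq_sqrt (hR.hess_nonneg hF hh u)).symm
  have h0 : h + (0 : ℝ) • u ∈ interior F := by simpa using hh
  have h1 : h + (1 : ℝ) • u ∈ interior F := by simpa [hu] using hg
  have hin : ∀ t ∈ Set.Icc (0 : ℝ) 1, h + t • u ∈ interior F := fun t ht =>
    (convex_line hF h u).ordConnected.out h0 h1 ht
  set p' : ℝ → ℝ := fun t => η * inner ℝ u S + fderiv ℝ R (h + t • u) u with hp'
  have hp : ∀ t, h + t • u ∈ interior F →
      HasDerivAt (fun s : ℝ => η * inner ℝ (h + s • u) S + R (h + s • u)) (p' t) t := by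
    intro t ht
    refine HasDerivAt.add (HasDerivAt.const_mul η ?_) (hR.hasDerivAt_line ht)
    have : (fun s : ℝ => inner ℝ (h + s • u) S) = fun s : ℝ => inner ℝ h S + s * inner ℝ u S := by
      ext s
      rw [inner_add_left, real_inner_smul_left]
    rw [this]
    simpa using ((hasDerivAt_id t).mul_const (inner ℝ u S)).const_add (inner ℝ h S)
  have hcrit : p' 0 = 0 := by
    refine IsLocalMin.hasDerivAt_eq_zero ?_ (hp 0 h0)
    filter_upwards [(isOpen_line F h u).mem_nhds h0] with t ht
    simpa using hmin ht
  have hden : ∀ t ∈ Set.Icc (0 : ℝ) 1, 0 < 1 + r * t := fun t ht => by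
    have := mul_nonneg hr0 ht.1
    linarith
  -- The Hessian along the segment is at least `r²/(1+rt)²`, the derivative of `r² t/(1+rt)`.
  -- Integrating once from the critical point gives this bound, with the denominator enlarged to `1
  -- + r`. Integrating again gives `r²/(2(1+r))`.
  have hgrad : ∀ t ∈ Set.Icc (0 : ℝ) 1, r ^ 2 * t / (1 + r) ≤ p' t := by
    intro t ht
    have hmono : MonotoneOn (fun t => p' t - r ^ 2 * t / (1 + r * t)) (Set.Icc 0 1) := by
      have hd : ∀ t ∈ Set.Icc (0 : ℝ) 1, HasDerivAt (fun t => p' t - r ^ 2 * t / (1 + r * t))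
          (hess R (h + t • u) u u - r ^ 2 / (1 + r * t) ^ 2) t := by
        intro t ht
        have ha := (hR.hasDerivAt_fderiv_line (hin t ht)).const_add (η * inner ℝ u S)
        have hb := ((hasDerivAt_id' t).const_mul (r ^ 2)).fun_div
          (((hasDerivAt_id' t).const_mul r).const_add 1) (hden t ht).ne'
        refine (ha.fun_sub hb).congr_deriv ?_
        ring
      refine monotoneOn_of_hasDerivWithinAt_nonneg (convex_Icc 0 1)
        (fun t ht => (hd t ht).continuousAt.continuousWithinAt)
        (fun t ht => (hd t (interior_subset ht)).hasDerivWithinAt) fun t ht => ?_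
      have ht := interior_subset ht
      have hsq := hR.sqrt_hess_sub_le hF (hin t ht) h0
      rw [zero_smul, add_zero, zero_sub, abs_neg, abs_of_nonneg ht.1, ← hr] at hsq
      have hnn := hR.hess_nonneg hF (hin t ht) u
      have hle : r / (1 + r * t) ≤ √(hess R (h + t • u) u u) := by
        rw [div_le_iff₀ (hden t ht)]
        linarith
      rw [sub_nonneg, ← div_pow, ← Real.sq_sqrt hnn]
      have := (hden t ht).le
      gcongr
    have := hmono (Set.left_mem_Icc.2 zero_le_one) ht ht.1
    simp only [hcrit, mul_zero, zero_div, sub_zero] at this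
    have h2 : r ^ 2 * t / (1 + r) ≤ r ^ 2 * t / (1 + r * t) := by
      have := ht.1
      have := hden t ht
      gcongr
      exact mul_le_of_le_one_right hr0 ht.2
    linarith
  have hmono : MonotoneOn (fun t : ℝ => (η * inner ℝ (h + t • u) S + R (h + t • u)) -
      r ^ 2 / (2 * (1 + r)) * t ^ 2) (Set.Icc 0 1) := by
    have hd : ∀ t ∈ Set.Icc (0 : ℝ) 1, HasDerivAt
        (fun t : ℝ => (η * inner ℝ (h + t • u) S + R (h + t • u)) -
          r ^ 2 / (2 * (1 + r)) * t ^ 2) (p' t - r ^ 2 * t / (1 + r)) t := by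
      intro t ht
      have hb := ((hasDerivAt_id' t).fun_pow 2).const_mul (r ^ 2 / (2 * (1 + r)))
      refine ((hp t (hin t ht)).fun_sub hb).congr_deriv ?_
      field_simp
      push_cast
      ring
    exact monotoneOn_of_hasDerivWithinAt_nonneg (convex_Icc 0 1)
      (fun t ht => (hd t ht).continuousAt.continuousWithinAt)
      (fun t ht => (hd t (interior_subset ht)).hasDerivWithinAt)
      fun t ht => sub_nonneg.2 (hgrad t (interior_subset ht))
  have := hmono (Set.left_mem_Icc.2 zero_le_one) (Set.right_mem_Icc.2 zero_le_one) zero_le_one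
  have hgu : h + u = g := by simp [hu]
  simp only [zero_smul, add_zero, one_smul, hgu, zero_pow two_ne_zero, mul_zero, sub_zero,
    one_pow, mul_one] at this
  rw [hrsq]
  linarith

end IsSelfConcordantBarrier

/-! ### Averages over draws and scalar inequalities -/

theorem sum_mul_sign_add_eq {n : ℕ} (a b : Fin n → ℝ) :
    ∑ d : Draw n, (d.sign * a d.1 + b d.1) = 2 * ∑ i, b i := by
  rw [Fintype.sum_prod_type, Finset.mul_sum]
  refine Finset.sum_congr rfl fun i _ => ?_
  have : (Finset.univ : Finset ℤˣ) = {1, -1} := by decide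
  rw [this, Finset.sum_pair (by decide)]
  simp only [Draw.sign]
  push_cast
  ring

theorem Draw.sign_sq {n : ℕ} (d : Draw n) : d.sign ^ 2 = 1 := by
  rcases Int.units_eq_one_or d.2 with h | h <;> simp [Draw.sign, h]

/-- Averaging over one coordinate first does not change a vanishing sum. -/
theorem sum_eq_zero_of_sum_update_eq_zero {T : ℕ} {D : Type*} [Fintype D] [Nonempty D]
    (G : (Fin T → D) → ℝ) (t : Fin T)
    (h : ∀ ω, ∑ d, G (Function.update ω t d) = 0) : ∑ ω, G ω = 0 := by
  -- Swapping `ω t` with a fresh draw permutes the pairs, so resampling coordinate `t` leaves the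
  -- total over all pairs unchanged. This plays the role of conditioning on the other rounds.
  have hinv : Function.Involutive
      fun p : (Fin T → D) × D => (Function.update p.1 t p.2, p.1 t) := by
    rintro ⟨ω, d⟩
    simp
  have h1 : ∑ p : (Fin T → D) × D, G (Function.update p.1 t p.2) =
      ∑ p : (Fin T → D) × D, G p.1 :=
    Fintype.sum_equiv hinv.toPerm _ _ fun _ => rfl
  rw [Fintype.sum_prod_type, Fintype.sum_prod_type, Finset.sum_eq_zero fun ω _ => h ω] at h1
  simp only [Finset.sum_const, nsmul_eq_mul, ← Finset.mul_sum] at h1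
  exact (mul_eq_zero.1 h1.symm).resolve_left (by simp)

/-- Source of the factor 2 in the regret bound. After clearing denominators the difference is
`(1-2s)(r-s)² + 3s² + 2s³`. -/
theorem mul_sub_le_sq_div {r s : ℝ} (hr : 0 ≤ r) (hs0 : 0 ≤ s) (hs : s < 1 / 4) :
    s * r - 2 * s ^ 2 ≤ r ^ 2 / (2 * (1 + r)) := by
  rw [le_div_iff₀ (by positivity)]
  nlinarith [mul_nonneg (by linarith : 0 ≤ 1 - 2 * s) (sq_nonneg (r - s)),
    mul_nonneg hs0 (sq_nonneg s), sq_nonneg s]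

theorem hess_eq_sum_of_eigenbasis {n : ℕ} {R : Vec n → ℝ} {h : Vec n}
    (e : OrthonormalBasis (Fin n) ℝ (Vec n)) {lam : Fin n → ℝ}
    (he : ∀ i w, hess R h (e i) w = lam i * inner ℝ (e i) w) (u : Vec n) :
    hess R h u u = ∑ i, lam i * inner ℝ (e i) u ^ 2 := by
  have hu : hess R h u u = hess R h (∑ i, inner ℝ (e i) u • e i) u := by rw [e.sum_repr' u]
  rw [hu]
  unfold hess at he ⊢
  simp only [map_sum, map_smul, sum_apply, smul_apply, he, smul_eq_mul]
  exact Finset.sum_congr rfl fun i _ => by ring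

/-- By convexity `exp` lies below its chord over `[-4, 0]`. Since `e⁻⁴ ≤ 1/5`, the decay rate `1/5`
is available; the smaller `2/13` suffices for the final constant `13 = 2 · 13/2`. -/
theorem exp_neg_le_one_sub {L : ℝ} (h0 : 0 ≤ L) (h4 : L ≤ 4) : Real.exp (-L) ≤ 1 - 2 / 13 * L := by
  have h1 := convexOn_exp.2 (Set.mem_univ (-4)) (Set.mem_univ 0)
    (by linarith : 0 ≤ L / 4) (by linarith : 0 ≤ 1 - L / 4) (by ring)
  have h2 : Real.exp (-4) ≤ 1 / 5 := by
    rw [Real.exp_neg, ← one_div]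
    gcongr
    linarith [Real.add_one_le_exp 4]
  simp only [smul_eq_mul, mul_zero, add_zero, Real.exp_zero, mul_one] at h1
  have h3 : L / 4 * -4 = -L := by ring
  rw [h3] at h1
  nlinarith

/-- One round of exponential weights for the squares of numbers in `[-2, 2]`. -/
theorem log_expWeights_step {Model : Type*} [Fintype Model] {q a : Model → ℝ}
    (hq : ∀ π, 0 < q π) (hsum : ∑ π, q π = 1) (ha : ∀ π, a π ^ 2 ≤ 4) (π : Model) :
    Real.log (q π) - a π ^ 2 + 2 / 13 * (∑ ρ, q ρ * a ρ) ^ 2 ≤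
      Real.log (q π * Real.exp (-a π ^ 2) / ∑ ρ, q ρ * Real.exp (-a ρ ^ 2)) := by
  have hZ : 0 < ∑ ρ, q ρ * Real.exp (-a ρ ^ 2) :=
    Finset.sum_pos (fun ρ _ => mul_pos (hq ρ) (Real.exp_pos _)) ⟨π, Finset.mem_univ π⟩
  have h1 : ∑ ρ, q ρ * Real.exp (-a ρ ^ 2) ≤ 1 - 2 / 13 * ∑ ρ, q ρ * a ρ ^ 2 := by
    rw [← hsum, Finset.mul_sum, ← Finset.sum_sub_distrib]
    refine Finset.sum_le_sum fun ρ _ => ?_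
    have := mul_le_mul_of_nonneg_left (exp_neg_le_one_sub (sq_nonneg (a ρ)) (ha ρ)) (hq ρ).le
    linarith
  have h2 : (∑ ρ, q ρ * a ρ) ^ 2 ≤ ∑ ρ, q ρ * a ρ ^ 2 :=
    Real.pow_arith_mean_le_arith_mean_pow_of_even _ _ _ (fun ρ _ => (hq ρ).le) hsum even_two
  -- Together with Jensen in `h2`, the log of the normalizer is at most `-2/13` times the squared
  -- mean: its decrease pays for the error of the mixed prediction.
  have h3 := Real.log_le_sub_one_of_pos hZ
  rw [Real.log_div (mul_pos (hq π) (Real.exp_pos _)).ne' hZ.ne',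
    Real.log_mul (hq π).ne' (Real.exp_pos _).ne', Real.log_exp]
  linarith

/-! ### A single round: feasibility and unbiasedness -/

namespace BanditGame

variable {n : ℕ} {Model : Type*} [Fintype Model] {A : BanditGame n Model}

/-- As `M_1 = 0` and the initial sum is zero, the separately defined first round obeys the general
rule. -/
theorem center_eq_regLeader
    (hM_first : ∀ past : Fin 0 → Draw n,
      ∑ π, (1 / (Fintype.card Model : ℝ)) • A.M π 0 past = 0) (t : ℕ) (past : Fin t → Draw n) :
    A.center t past = regLeader A.F A.R A.η
      ((A.state t past).S + A.mixOf (A.state t past) t past) := by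
  cases t with
  | zero =>
    have h : A.mixOf (A.state 0 past) 0 past = 0 := hM_first past
    rw [h]
    simp [center, centerOf, state]
  | succ t => rfl

theorem norm_playOf_le_one (hF_convex : Convex ℝ A.F) (hF_closed : IsClosed A.F)
    (hF_ball : A.F ⊆ Metric.closedBall 0 1) (hR : IsSelfConcordantBarrier A.F A.R) {t : ℕ}
    {past : Fin t → Draw n} (hc : A.center t past ∈ interior A.F)
    (h_eig : ∀ i w, hess A.R (A.center t past) (A.eigvec t past i) w =
      A.eigval t past i * inner ℝ (A.eigvec t past i) w) (d : Draw n) :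
    ‖A.playOf (A.state t past) t past d‖ ≤ 1 := by
  rw [← mem_closedBall_zero_iff]
  -- The displacement has local norm exactly 1 when the eigenvalue is positive, so the closed
  -- ellipsoid is needed.
  refine hF_ball (hR.add_mem_of_hess_le_one hF_convex hF_closed hc ?_)
  set c := d.sign * (√(A.eigval t past d.1))⁻¹ with hc'
  have h1 : hess A.R (A.center t past) (c • A.eigvec t past d.1) (c • A.eigvec t past d.1) =
      c * (c * hess A.R (A.center t past) (A.eigvec t past d.1) (A.eigvec t past d.1)) := by
    simp [hess]
  have h2 := hR.hess_nonneg hF_convex hc (A.eigvec t past d.1)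
  rw [h_eig, real_inner_self_eq_norm_sq, (A.eigvec t past).norm_eq_one] at h2
  change hess A.R (A.center t past) (c • _) (c • _) ≤ 1
  rw [h1, h_eig, real_inner_self_eq_norm_sq, (A.eigvec t past).norm_eq_one, hc']
  have h3 : d.sign * (√(A.eigval t past d.1))⁻¹ *
      (d.sign * (√(A.eigval t past d.1))⁻¹ * (A.eigval t past d.1 * 1 ^ 2)) =
      d.sign ^ 2 * (A.eigval t past d.1 / √(A.eigval t past d.1) ^ 2) := by ring
  rw [h3, d.sign_sq, one_mul, Real.sq_sqrt (by linarith)]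
  exact div_self_le_one _

/-- Replacing Nature's move by its estimate does not change the expected regret of a round. -/
theorem sum_regret_sub_estimate_eq_zero (hn : n ≠ 0) (s : LearnerState n Model) {t : ℕ}
    {past : Fin t → Draw n} (hpos : ∀ i, 0 < A.eigval t past i) (v : Vec n) :
    ∑ d : Draw n, (inner ℝ (A.playOf s t past d) (A.x t past) - inner ℝ v (A.x t past) -
      inner ℝ (A.centerOf s t past - v) (A.estimateOf s t past d)) = 0 := by
  set e := A.eigvec t past with he
  set lam := A.eigval t past with hlam
  set h := A.centerOf s t past with hh
  set y := A.x t past with hy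
  set m := A.mixOf s t past with hm
  -- Split into parts odd and even in the sign, using `ε² = 1`. The odd part cancels over `ε`; the
  -- even part cancels over `i` by Parseval, the factor `n` compensating the uniform choice of
  -- index.
  have hexp : ∀ d : Draw n,
      inner ℝ (A.playOf s t past d) y - inner ℝ v y -
        inner ℝ (h - v) (A.estimateOf s t past d) =
      d.sign * ((√(lam d.1))⁻¹ * inner ℝ (e d.1) y -
        n * √(lam d.1) * inner ℝ h (y - m) * inner ℝ (h - v) (e d.1)) +
      (inner ℝ (h - v) (y - m) - n * (inner ℝ (h - v) (e d.1) * inner ℝ (e d.1) (y - m))) := by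
    intro d
    have hs : √(lam d.1) ≠ 0 := (Real.sqrt_pos.2 (hpos d.1)).ne'
    simp only [playOf, estimateOf, ← he, ← hlam, ← hh, ← hy, ← hm, inner_add_left, inner_add_right,
      real_inner_smul_left, real_inner_smul_right]
    have h1 : inner ℝ (h - v) (y - m) = inner ℝ h y - inner ℝ v y - inner ℝ (h - v) m := by
      rw [inner_sub_right, inner_sub_left]
    have h2 : (n : ℝ) * (inner ℝ h (y - m) + d.sign * (√(lam d.1))⁻¹ * inner ℝ (e d.1) (y - m)) *
        d.sign * √(lam d.1) = d.sign * (n * √(lam d.1) * inner ℝ h (y - m)) +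
        d.sign ^ 2 * (n * inner ℝ (e d.1) (y - m)) := by
      field_simp
    rw [h1, h2, d.sign_sq]
    ring
  rw [Finset.sum_congr rfl fun d _ => hexp d,
    sum_mul_sign_add_eq (fun i => (√(lam i))⁻¹ * inner ℝ (e i) y -
        n * √(lam i) * inner ℝ h (y - m) * inner ℝ (h - v) (e i))
      (fun i => inner ℝ (h - v) (y - m) - n * (inner ℝ (h - v) (e i) * inner ℝ (e i) (y - m))),
    Finset.sum_sub_distrib, ← Finset.mul_sum, e.sum_inner_mul_inner]
  simp

theorem before_update {T : ℕ} (ω : Fin T → Draw n) (t : Fin T) (d : Draw n) :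
    before (Function.update ω t d) t = before ω t := by
  funext s
  have : Fin.castLE t.isLt.le s ≠ t := fun h => by
    have := congrArg Fin.val h
    simp at this
    omega
  simp [before, this]

/-! ### Deterministic bounds along one infinite sequence of draws -/

section Path

variable (A) (ω : ℕ → Draw n)

/-- The state of the learner at time `t` along an infinite sequence of draws. -/
noncomputable def pathState (t : ℕ) : LearnerState n Model := A.state t fun s => ω s

/-- The center at time `t` along an infinite sequence of draws. -/
noncomputable def pathCenter (t : ℕ) : Vec n := A.center t fun s => ω s

/-- The estimated move at time `t` along an infinite sequence of draws. -/
noncomputable def pathEstimate (t : ℕ) : Vec n := A.estimateOf (A.pathState ω t) t (fun s => ω s) (ω t)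

/-- The decision at time `t` along an infinite sequence of draws. -/
noncomputable def pathPlay (t : ℕ) : Vec n := A.playOf (A.pathState ω t) t (fun s => ω s) (ω t)

/-- The mixed prediction at time `t` along an infinite sequence of draws. -/
noncomputable def pathMix (t : ℕ) : Vec n := A.mixOf (A.pathState ω t) t fun s => ω s

/-- The prediction error `⟨f_t, x_t - M_t⟩` along an infinite sequence of draws. -/
noncomputable def pathError (t : ℕ) : ℝ :=
  inner ℝ (A.pathPlay ω t) (A.x t (fun s => ω s) - A.pathMix ω t)

variable {A}

theorem pathState_succ_S (t : ℕ) :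
    (A.pathState ω (t + 1)).S = (A.pathState ω t).S + A.pathEstimate ω t := rfl

theorem pathState_succ_q (t : ℕ) (π : Model) :
    (A.pathState ω (t + 1)).q π = A.weightOf (A.pathState ω t) t (fun s => ω s) (ω t) π /
      ∑ ρ, A.weightOf (A.pathState ω t) t (fun s => ω s) (ω t) ρ := rfl

theorem pathState_S_eq_sum (T : ℕ) :
    (A.pathState ω T).S = ∑ t ∈ Finset.range T, A.pathEstimate ω t := by
  induction T with
  | zero => rfl
  | succ T ih => rw [pathState_succ_S, Finset.sum_range_succ, ih]

/-- Cauchy–Schwarz for the local norm and its dual. The vector `x̃_t - M_t` is a multiple of one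
eigenvector, so a single term of the eigenexpansion of the Hessian suffices. -/
theorem inner_sub_estimate_le (hF_convex : Convex ℝ A.F)
    (hR : IsSelfConcordantBarrier A.F A.R) {t : ℕ}
    (hc : A.pathCenter ω t ∈ interior A.F)
    (h_eig : ∀ i w, hess A.R (A.pathCenter ω t) (A.eigvec t (fun s => ω s) i) w =
      A.eigval t (fun s => ω s) i * inner ℝ (A.eigvec t (fun s => ω s) i) w) (u : Vec n) :
    |inner ℝ u (A.pathEstimate ω t - A.pathMix ω t)| ≤
      n * |A.pathError ω t| * √(hess A.R (A.pathCenter ω t) u u) := by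
  set e := A.eigvec t (fun s => ω s) with he
  set lam := A.eigval t (fun s => ω s) with hlam
  have hnn : ∀ i, 0 ≤ lam i := fun i => by
    have := hR.hess_nonneg hF_convex hc (e i)
    rwa [h_eig, real_inner_self_eq_norm_sq, e.norm_eq_one, one_pow, mul_one] at this
  have hest : A.pathEstimate ω t - A.pathMix ω t =
      (n * A.pathError ω t * (ω t).sign * √(lam (ω t).1)) • e (ω t).1 := by
    simp only [pathEstimate, estimateOf, pathMix, add_sub_cancel_right, pathError, pathPlay, he,
      hlam]
  have hsgn : |(ω t).sign| = 1 := by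
    rw [← sq_eq_sq₀ (abs_nonneg _) zero_le_one, sq_abs, Draw.sign_sq, one_pow]
  rw [hest, real_inner_smul_right, abs_mul, abs_mul, abs_mul, abs_mul, hsgn, Nat.abs_cast,
    mul_one, mul_assoc, abs_of_nonneg (Real.sqrt_nonneg _)]
  refine mul_le_mul_of_nonneg_left ?_ (by positivity)
  refine Real.le_sqrt_of_sq_le ?_
  rw [mul_pow, Real.sq_sqrt (hnn _), sq_abs, real_inner_comm, hess_eq_sum_of_eigenbasis e h_eig]
  exact Finset.single_le_sum (f := fun i => lam i * inner ℝ (e i) u ^ 2)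
    (fun i _ => mul_nonneg (hnn i) (sq_nonneg _)) (Finset.mem_univ _)

/-- Quantifying over every `g` lets the induction hypothesis be used at the next center `h_T`.
Growth around `h_T`, which minimizes the objective with the guess `M_T` included, then passes to
arbitrary `g` and pays for the error `x̃_T - M_T`. -/
theorem sum_le_objective (hF_convex : Convex ℝ A.F) (hR : IsSelfConcordantBarrier A.F A.R)
    (hR_nonneg : ∀ g ∈ interior A.F, 0 ≤ A.R g) (hη : 0 < A.η)
    (hc : ∀ t, A.pathCenter ω t ∈ interior A.F)
    (hmin : ∀ t, IsMinOn (fun g => A.η * inner ℝ g ((A.pathState ω t).S + A.pathMix ω t) + A.R g)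
      (interior A.F) (A.pathCenter ω t))
    (h_eig : ∀ t i w, hess A.R (A.pathCenter ω t) (A.eigvec t (fun s => ω s) i) w =
      A.eigval t (fun s => ω s) i * inner ℝ (A.eigvec t (fun s => ω s) i) w) (T : ℕ)
    (h_step : ∀ t < T, A.η * (n * |A.pathError ω t|) < 1 / 4) :
    ∀ g ∈ interior A.F,
      ∑ t ∈ Finset.range T, (A.η * inner ℝ (A.pathCenter ω t) (A.pathEstimate ω t) -
        2 * (A.η * (n * |A.pathError ω t|)) ^ 2) ≤
      A.η * inner ℝ g (A.pathState ω T).S + A.R g := by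
  induction T with
  | zero =>
    intro g hg
    have : (A.pathState ω 0).S = 0 := rfl
    simpa [this] using hR_nonneg g hg
  | succ T ih =>
    intro g hg
    have h1 := ih (fun t ht => h_step t (ht.trans T.lt_succ_self)) _ (hc T)
    have h2 := hR.le_sub_of_isMinOn hF_convex (hc T) hg (hmin T)
    have h3 := inner_sub_estimate_le ω hF_convex hR (hc T) (h_eig T) (g - A.pathCenter ω T)
    set h := A.pathCenter ω T
    set m := A.pathMix ω T
    set x := A.pathEstimate ω T
    set S := (A.pathState ω T).S
    set r := √(hess A.R h (g - h) (g - h)) with hr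
    set s := A.η * (n * |A.pathError ω T|) with hs
    have hs0 : 0 ≤ s := by positivity
    have h4 := mul_sub_le_sq_div (Real.sqrt_nonneg _ : 0 ≤ r) hs0 (h_step T T.lt_succ_self)
    rw [Real.sq_sqrt (hR.hess_nonneg hF_convex (hc T) _)] at h4
    have h5 : -(s * r) ≤ A.η * inner ℝ (g - h) (x - m) := by
      have := mul_le_mul_of_nonneg_left ((neg_abs_le _).trans' (neg_le_neg h3)) hη.le
      rw [hs]
      linarith
    rw [Finset.sum_range_succ, pathState_succ_S]
    simp only [inner_add_right, inner_sub_left, inner_sub_right] at h2 h5 ⊢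
    linarith

theorem sum_inner_estimate_le (hF_convex : Convex ℝ A.F)
    (hR : IsSelfConcordantBarrier A.F A.R)
    (hR_nonneg : ∀ g ∈ interior A.F, 0 ≤ A.R g) (hη : 0 < A.η)
    (hc : ∀ t, A.pathCenter ω t ∈ interior A.F)
    (hmin : ∀ t, IsMinOn (fun g => A.η * inner ℝ g ((A.pathState ω t).S + A.pathMix ω t) + A.R g)
      (interior A.F) (A.pathCenter ω t))
    (h_eig : ∀ t i w, hess A.R (A.pathCenter ω t) (A.eigvec t (fun s => ω s) i) w =
      A.eigval t (fun s => ω s) i * inner ℝ (A.eigvec t (fun s => ω s) i) w) (T : ℕ)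
    (h_step : ∀ t < T, A.η * (n * |A.pathError ω t|) < 1 / 4) {v : Vec n}
    (hv : v ∈ interior A.F) :
    ∑ t ∈ Finset.range T, inner ℝ (A.pathCenter ω t - v) (A.pathEstimate ω t) ≤
      A.η⁻¹ * A.R v + 2 * A.η * (n : ℝ) ^ 2 * ∑ t ∈ Finset.range T, A.pathError ω t ^ 2 := by
  have h := sum_le_objective ω hF_convex hR hR_nonneg hη hc hmin h_eig T h_step v hv
  have h1 : ∀ t, 2 * (A.η * (n * |A.pathError ω t|)) ^ 2 =
      A.η * (2 * A.η * (n : ℝ) ^ 2) * A.pathError ω t ^ 2 := fun t => by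
    rw [mul_pow, mul_pow, sq_abs]
    ring
  simp only [h1] at h
  rw [Finset.sum_sub_distrib, ← Finset.mul_sum, ← Finset.mul_sum, pathState_S_eq_sum,
    inner_sum] at h
  simp only [inner_sub_left]
  rw [Finset.sum_sub_distrib]
  refine le_of_mul_le_mul_left ?_ hη
  rw [mul_add, mul_inv_cancel_left₀ hη.ne']
  linarith

theorem pathState_q_pos_and_sum [Nonempty Model] (t : ℕ) :
    (∀ π, 0 < (A.pathState ω t).q π) ∧ ∑ π, (A.pathState ω t).q π = 1 := by
  induction t with
  | zero =>
    have : ∀ π, (A.pathState ω 0).q π = 1 / (Fintype.card Model : ℝ) := fun _ => rfl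
    simp [this, Fintype.card_pos]
  | succ t ih =>
    have hw : ∀ π, 0 < A.weightOf (A.pathState ω t) t (fun s => ω s) (ω t) π := fun π =>
      mul_pos (ih.1 π) (Real.exp_pos _)
    have hZ : 0 < ∑ ρ, A.weightOf (A.pathState ω t) t (fun s => ω s) (ω t) ρ :=
      Finset.sum_pos (fun ρ _ => hw ρ) Finset.univ_nonempty
    simp only [pathState_succ_q]
    exact ⟨fun π => div_pos (hw π) hZ, by rw [← Finset.sum_div, div_self hZ.ne']⟩

/-- The potential is `log q_t(π)`: it starts at `-log |Π|`, never exceeds 0, and in each round gains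
`2/13` of the squared error minus at most the model's squared distance. -/
theorem sum_pathError_sq_le [Nonempty Model] (hf : ∀ t, ‖A.pathPlay ω t‖ ≤ 1)
    (hx : ∀ t past, ‖A.x t past‖ ≤ 1) (hM : ∀ π t past, ‖A.M π t past‖ ≤ 1) (T : ℕ) (π : Model) :
    ∑ t ∈ Finset.range T, A.pathError ω t ^ 2 ≤
      13 / 2 * (∑ t ∈ Finset.range T, ‖A.x t (fun s => ω s) - A.M π t fun s => ω s‖ ^ 2 +
        Real.log (Fintype.card Model)) := by
  have key : ∀ T, 2 / 13 * ∑ t ∈ Finset.range T, A.pathError ω t ^ 2 -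
      ∑ t ∈ Finset.range T, ‖A.x t (fun s => ω s) - A.M π t fun s => ω s‖ ^ 2 -
        Real.log (Fintype.card Model) ≤ Real.log ((A.pathState ω T).q π) := by
    intro T
    induction T with
    | zero =>
      have : (A.pathState ω 0).q π = 1 / (Fintype.card Model : ℝ) := rfl
      simp [this]
    | succ T ih =>
      obtain ⟨hq, hsum⟩ := pathState_q_pos_and_sum (A := A) ω T
      set a : Model → ℝ := fun ρ => inner ℝ (A.pathPlay ω T) (A.x T fun s => ω s) -
        inner ℝ (A.pathPlay ω T) (A.M ρ T fun s => ω s) with ha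
      have ha_le : ∀ ρ, a ρ ^ 2 ≤ ‖A.x T (fun s => ω s) - A.M ρ T fun s => ω s‖ ^ 2 := by
        intro ρ
        simp only [ha, ← inner_sub_right]
        rw [← sq_abs]
        refine pow_le_pow_left₀ (abs_nonneg _) ((abs_real_inner_le_norm _ _).trans ?_) 2
        exact mul_le_of_le_one_left (norm_nonneg _) (hf T)
      have ha4 : ∀ ρ, a ρ ^ 2 ≤ 4 := by
        intro ρ
        have h1 := (norm_sub_le (A.x T fun s => ω s) (A.M ρ T fun s => ω s)).trans
          (add_le_add (hx T _) (hM ρ T _))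
        have h2 := pow_le_pow_left₀ (norm_nonneg _) h1 2
        linarith [ha_le ρ]
      have herr : ∑ ρ, (A.pathState ω T).q ρ * a ρ = A.pathError ω T := by
        simp only [ha, pathError, pathMix, mixOf, mul_sub, Finset.sum_sub_distrib,
          ← Finset.sum_mul, hsum, one_mul, inner_sub_right, inner_sum, real_inner_smul_right]
      have h := log_expWeights_step hq hsum ha4 π
      rw [herr] at h
      have hnext : (A.pathState ω (T + 1)).q π = (A.pathState ω T).q π * Real.exp (-a π ^ 2) /
          ∑ ρ, (A.pathState ω T).q ρ * Real.exp (-a ρ ^ 2) := rfl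
      rw [hnext, Finset.sum_range_succ, Finset.sum_range_succ]
      linarith [ha_le π]
  obtain ⟨hq, hsum⟩ := pathState_q_pos_and_sum (A := A) ω T
  have hle : (A.pathState ω T).q π ≤ 1 :=
    hsum ▸ Finset.single_le_sum (fun ρ _ => (hq ρ).le) (Finset.mem_univ π)
  linarith [key T, Real.log_nonpos (hq π).le hle]

end Path

end BanditGame

/-! ### Averaging the pathwise bounds -/

theorem mainTheorem10 {n : ℕ} [NeZero n] {Model : Type*} [Fintype Model] [Nonempty Model]
    (A : BanditGame n Model) (X : Set (Vec n)) (T : ℕ)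
    (hF_convex : Convex ℝ A.F) (hF_compact : IsCompact A.F)
    (hF_ball : A.F ⊆ Metric.closedBall 0 1) (hX_ball : X ⊆ Metric.closedBall 0 1)
    (hR : IsSelfConcordantBarrier A.F A.R) (hR_min : IsLeast (A.R '' interior A.F) 0)
    (hη : 0 < A.η)
    (hx : ∀ t past, A.x t past ∈ X)
    (hM : ∀ π t past, A.M π t past ∈ Metric.closedBall 0 1)
    (h_eig : ∀ t past i w, hess A.R (A.center t past) (A.eigvec t past i) w =
      A.eigval t past i * inner ℝ (A.eigvec t past i) w)
    -- the first mixed prediction is zero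
    (hM_first : ∀ past : Fin 0 → Draw n,
      ∑ π, (1 / (Fintype.card Model : ℝ)) • A.M π 0 past = 0)
    -- the step-size condition; the left side is `η` times the dual local norm of `x̃_t - M_t`
    (h_step : ∀ (ω : Fin T → Draw n) (t : Fin T),
      A.η * (n * |inner ℝ (A.fAt ω t) (A.xAt ω t - A.mixAt ω t)|) < 1 / 4)
    (fstar : Vec n) (hfstar : fstar ∈ interior A.F) :
    (𝔼 ω : Fin T → Draw n,
        (∑ t, inner ℝ (A.fAt ω t) (A.xAt ω t) - ∑ t, inner ℝ fstar (A.xAt ω t))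
      ≤ A.η⁻¹ * A.R fstar + 2 * A.η * (n : ℝ) ^ 2 *
          𝔼 ω : Fin T → Draw n,
            ∑ t, (inner ℝ (A.fAt ω t) (A.xAt ω t - A.mixAt ω t)) ^ 2) ∧
    (A.η⁻¹ * A.R fstar + 2 * A.η * (n : ℝ) ^ 2 *
          𝔼 ω : Fin T → Draw n,
            ∑ t, (inner ℝ (A.fAt ω t) (A.xAt ω t - A.mixAt ω t)) ^ 2
      ≤ A.η⁻¹ * A.R fstar + 13 * A.η * (n : ℝ) ^ 2 *
          ((𝔼 ω : Fin T → Draw n, ⨅ π, ∑ t, ‖A.xAt ω t - A.modelAt π ω t‖ ^ 2) +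
            Real.log (Fintype.card Model))) := by
  have hn : n ≠ 0 := NeZero.ne n
  have hx1 : ∀ t past, ‖A.x t past‖ ≤ 1 := fun t past =>
    mem_closedBall_zero_iff.1 (hX_ball (hx t past))
  have hM1 : ∀ π t past, ‖A.M π t past‖ ≤ 1 := fun π t past =>
    mem_closedBall_zero_iff.1 (hM π t past)
  have hR_nonneg : ∀ g ∈ interior A.F, 0 ≤ A.R g := fun g hg => hR_min.2 ⟨g, hg, rfl⟩
  have hspec : ∀ t past, A.center t past ∈ interior A.F ∧
      IsMinOn (fun g => A.η * inner ℝ g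
        ((A.state t past).S + A.mixOf (A.state t past) t past) + A.R g)
        (interior A.F) (A.center t past) := by
    intro t past
    rw [BanditGame.center_eq_regLeader hM_first]
    exact hR.regLeader_spec hF_compact ⟨fstar, hfstar⟩ _ _
  -- Positivity makes `√λ` and its inverse cancel in the product of play and estimate, which
  -- unbiasedness requires.
  have hpos : ∀ t past i, 0 < A.eigval t past i := by
    intro t past i
    have hne : A.eigvec t past i ≠ 0 := by
      rw [← norm_ne_zero_iff, (A.eigvec t past).norm_eq_one]
      exact one_ne_zero
    have h := hR.hess_pos hF_convex hF_compact.isBounded (hspec t past).1 hne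
    rwa [h_eig, real_inner_self_eq_norm_sq, (A.eigvec t past).norm_eq_one, one_pow,
      mul_one] at h
  -- The draws after round `T` are filled with an arbitrary value; the sums over the first `T`
  -- rounds do not see them.
  have hpath : ∀ ω : Fin T → Draw n, ∃ ω' : ℕ → Draw n, ω = fun t : Fin T => ω' t := fun ω =>
    ⟨fun t => if ht : t < T then ω ⟨t, ht⟩ else (0, 1), by simp⟩
  constructor
  · have hzero : ∑ ω : Fin T → Draw n, ∑ t : Fin T,
        (inner ℝ (A.fAt ω t) (A.xAt ω t) - inner ℝ fstar (A.xAt ω t) -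
          inner ℝ (A.center t (BanditGame.before ω t) - fstar)
            (A.estimateOf (A.state t (BanditGame.before ω t)) t (BanditGame.before ω t) (ω t))) =
        0 := by
      rw [Finset.sum_comm]
      refine Finset.sum_eq_zero fun t _ => sum_eq_zero_of_sum_update_eq_zero _ t fun ω => ?_
      simp only [BanditGame.fAt, BanditGame.xAt, BanditGame.before_update,
        Function.update_self]
      exact BanditGame.sum_regret_sub_estimate_eq_zero hn _ (hpos t _) fstar
    have hregret : 𝔼 ω : Fin T → Draw n,
        (∑ t, inner ℝ (A.fAt ω t) (A.xAt ω t) - ∑ t, inner ℝ fstar (A.xAt ω t)) =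
        𝔼 ω : Fin T → Draw n, ∑ t : Fin T, inner ℝ (A.center t (BanditGame.before ω t) - fstar)
          (A.estimateOf (A.state t (BanditGame.before ω t)) t (BanditGame.before ω t) (ω t)) := by
      rw [Fintype.expect_eq_sum_div_card, Fintype.expect_eq_sum_div_card]
      congr 1
      rw [← sub_eq_zero, ← Finset.sum_sub_distrib, ← hzero]
      refine Finset.sum_congr rfl fun ω _ => ?_
      rw [← Finset.sum_sub_distrib, ← Finset.sum_sub_distrib]
    rw [hregret, Finset.mul_expect, ← Fintype.expect_const (ι := Fin T → Draw n)
      (A.η⁻¹ * A.R fstar), ← Finset.expect_add_distrib]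
    refine Finset.expect_le_expect fun ω _ => ?_
    obtain ⟨ω, rfl⟩ := hpath ω
    have h := BanditGame.sum_inner_estimate_le ω hF_convex hR hR_nonneg hη
      (fun t => (hspec t _).1) (fun t => (hspec t _).2) (fun t => h_eig t _) T
      (fun t ht => h_step (fun t : Fin T => ω t) ⟨t, ht⟩) hfstar
    rw [← Fin.sum_univ_eq_sum_range, ← Fin.sum_univ_eq_sum_range] at h
    exact h
  · rw [add_le_add_iff_left]
    have hdom : 𝔼 ω : Fin T → Draw n,
          ∑ t, (inner ℝ (A.fAt ω t) (A.xAt ω t - A.mixAt ω t)) ^ 2 ≤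
        13 / 2 * ((𝔼 ω : Fin T → Draw n, ⨅ π, ∑ t, ‖A.xAt ω t - A.modelAt π ω t‖ ^ 2) +
          Real.log (Fintype.card Model)) := by
      rw [← Fintype.expect_const (ι := Fin T → Draw n) (Real.log (Fintype.card Model)),
        ← Finset.expect_add_distrib, Finset.mul_expect]
      refine Finset.expect_le_expect fun ω _ => ?_
      obtain ⟨ω, rfl⟩ := hpath ω
      -- The best model may depend on `ω`; this is allowed because the exponential weights bound
      -- holds on each trajectory for every model.
      obtain ⟨π, hπ⟩ := exists_eq_ciInf_of_finite (f := fun π : Model =>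
        ∑ t : Fin T, ‖A.xAt (fun t : Fin T => ω t) t - A.modelAt π (fun t : Fin T => ω t) t‖ ^ 2)
      rw [← hπ]
      have h := BanditGame.sum_pathError_sq_le ω
        (fun t => BanditGame.norm_playOf_le_one hF_convex hF_compact.isClosed hF_ball hR
          (hspec t _).1 (h_eig t _) (ω t)) hx1 hM1 T π
      rw [← Fin.sum_univ_eq_sum_range, ← Fin.sum_univ_eq_sum_range
        (fun t => ‖A.x t (fun s => ω s) - A.M π t fun s => ω s‖ ^ 2)] at h
      exact h
    have := mul_le_mul_of_nonneg_left hdom (by positivity : 0 ≤ 2 * A.η * (n : ℝ) ^ 2)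
    linarith
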